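/- Let $k\ge 2$ and let $H=K^{(k)}_{k+1}$ be the $k$-uniform simplex: its vertex set is $[k+1]$ and its edges are all $k$-element subsets of $[k+1]$. A rooting of $H$ is an ordering $R=((e_1,v_1),\dots,(e_m,v_m))$ of the edges of $H$ with a chosen vertex $v_i\in e_i$ for each $i$ such that $v_1\le v_2\le\dots\le v_m$; its digraph $D_R$ has, for each $i$, one arc from $v_i$ to each other vertex of $e_i$ (multiplicities are added). The rooting is Euler if $D_R$ is Eulerian, i.e. connected with equal in- and out-degree at every vertex. The associated coefficient of $H$ is $$C_H=\sum_{R}\frac{\tau_{D_R}}{\prod_{v}\deg^-_{D_R}(v)},$$ where $R$ runs over the Euler rootings of $H$, $\deg^-$ is the in-degree and $\tau_D$ is the number of spanning arborescences of $D$ with a specified root $r$. Put $C_k=(k-1)^kC_H$. Let $P_{\ge2}(k+1)$ be the set of partitions of $k+1$ into parts of size at least $2$. For $p=(p_1,\dots,p_t)\in P_{\ge 2}(k+1)$ let $\mathfrak D_{k+1}(p)$ be the set of derangements of $[k+1]$ whose cycle lengths are the parts of $p$, and let $V_p(j)=|\{i:p_i=j\}|$. Then, whichever vertex $r$ is specified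 as the root, $$C_k=\frac{1}{(k-1)(k+1)^2}\sum_{p=(p_1,\dots,p_t)\in P_{\ge2}(k+1)}|\mathfrak D_{k+1}(p)|\prod_{i=1}^t\left(k^{p_i}+(-1)^{p_i+1}\right),$$ and for every $p=(p_1,\dots,p_t)\in P_{\ge2}(k+1)$ $$|\mathfrak D_{k+1}(p)|=\frac{(k+1)!}{\left(\prod_{i=1}^t p_i\right)\left(\prod_{j=2}^{k+1}V_p(j)!\right)}.$$ -/

import Mathlib

/-- A multi-hypergraph with vertex set `V`: a finite multiset of edges, each of which is a finite
set of vertices. -/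
structure MultiHypergraph (V : Type*) where
  /-- The multiset of edges. -/
  edges : Multiset (Finset V)

/-- A multi-digraph with vertex set `V`, given by its edge multiplicities:
`D u v` is the number of arcs from `u` to `v`. -/
abbrev MultiDigraph (V : Type*) : Type _ := V → V → ℕ

namespace MultiDigraph

variable {V : Type*}

/-- The out-degree `deg⁺`, counted with multiplicity. -/
def outDeg [Fintype V] (D : MultiDigraph V) (v : V) : ℕ := ∑ w, D v w

/-- The in-degree `deg⁻`, counted with multiplicity. -/
def inDeg [Fintype V] (D : MultiDigraph V) (v : V) : ℕ := ∑ u, D u v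

/-- A multi-digraph on the vertex set `V` is connected if any two vertices are joined by a path
that may use the arcs in either direction. -/
def Connected (D : MultiDigraph V) : Prop :=
  ∀ u v : V, Relation.EqvGen (fun x y => 0 < D x y) u v

/-- A multi-digraph is Eulerian if it is connected and every vertex has equal in- and
out-degree. -/
def IsEulerian [Fintype V] (D : MultiDigraph V) : Prop :=
  D.Connected ∧ ∀ v, D.inDeg v = D.outDeg v

/-- The arcs of a multi-digraph, parallel arcs being distinguished: `⟨(u, v), i⟩` is the `i`-th
arc from `u` to `v`. -/
abbrev Arc (D : MultiDigraph V) : Type _ := (p : V × V) × Fin (D p.1 p.2)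

/-- The set `T` of arcs is a spanning arborescence with root `r`: no arc of `T` enters `r`, exactly
one arc of `T` enters each other vertex, and every vertex can be reached from `r` along `T`. -/
def IsArborescence (D : MultiDigraph V) (r : V) (T : Finset D.Arc) : Prop :=
  (∀ a ∈ T, a.1.2 ≠ r) ∧
  (∀ v, v ≠ r → ∃! a, a ∈ T ∧ a.1.2 = v) ∧
  ∀ v, Relation.ReflTransGen (fun x y => ∃ a ∈ T, a.1 = (x, y)) r v

/-- `τ_D`: the number of spanning arborescences of `D` with root `r`. -/
noncomputable def numArborescences (D : MultiDigraph V) (r : V) : ℕ :=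
  Nat.card {T : Finset D.Arc // D.IsArborescence r T}

end MultiDigraph

/-- The `u`-rooted directed star of the edge `e`, as a multi-digraph: one arc from `u` to each
other vertex of `e`. -/
def rootedStar {V : Type*} [DecidableEq V] (e : Finset V) (u : V) : MultiDigraph V :=
  fun x y => if x = u ∧ y ∈ e ∧ y ≠ u then 1 else 0

/-- The rooted multi-digraph `D_R` of a list `R` of pairs `(e, u)`: the union of the `u`-rooted
stars of the edges `e`, multiplicities being added. -/
def rootedDigraph {V : Type*} [DecidableEq V] (R : List (Finset V × V)) : MultiDigraph V :=
  fun x y => (R.map fun s => rootedStar s.1 s.2 x y).sum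

namespace MultiHypergraph

variable {V : Type*}

/-- A rooting of `H`: an ordering of the edges of `H` (as a multiset), together with a choice of a
root in each edge, such that the roots are weakly increasing. The pair `(e, u)` stands for the
`u`-rooted star of `e`. -/
def IsRooting [LinearOrder V] (H : MultiHypergraph V) (R : List (Finset V × V)) : Prop :=
  ((R.map Prod.fst : List (Finset V)) : Multiset (Finset V)) = H.edges ∧
  (∀ s ∈ R, s.2 ∈ s.1) ∧
  R.Pairwise fun s t => s.2 ≤ t.2

/-- The Euler rootings of `H`: the rootings whose rooted multi-digraph is Eulerian. -/
def eulerRootings [Fintype V] [LinearOrder V] (H : MultiHypergraph V) :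
    Set (List (Finset V × V)) :=
  {R | H.IsRooting R ∧ (rootedDigraph R).IsEulerian}

theorem finite_eulerRootings [Fintype V] [LinearOrder V] (H : MultiHypergraph V) :
    H.eulerRootings.Finite := by
  refine (List.finite_length_eq (Finset V × V) (Multiset.card H.edges)).subset ?_
  rintro R ⟨⟨h, -, -⟩, -⟩
  simp [← h]

/-- The associated coefficient `C_H` of a connected Veblen hypergraph `H` with vertex set `V`:
the sum over all Euler rootings `R` of `τ_D / ∏ deg⁻(v)` with `D = D_R`. (Two Euler rootings with
the same digraph both count, so this is a sum over a multiset of digraphs.) The vertex `r` is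
the specified root of the arborescences. -/
noncomputable def assocCoeff [Fintype V] [LinearOrder V] (H : MultiHypergraph V) (r : V) : ℚ :=
  ∑ R ∈ H.finite_eulerRootings.toFinset,
    ((rootedDigraph R).numArborescences r : ℚ) / ∏ v, ((rootedDigraph R).inDeg v : ℚ)

end MultiHypergraph

/-- The `k`-uniform simplex: its vertex set has `k + 1` elements and its edges are all the
`k`-element subsets, once each. -/
def uniformSimplex (k : ℕ) : MultiHypergraph (Fin (k + 1)) where
  edges := (Finset.powersetCard k (Finset.univ : Finset (Fin (k + 1)))).val

/-- The simplex constant `C_k = (k - 1)^k C_H`, where `H` is the `k`-uniform simplex. -/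
noncomputable def simplexConstant (k : ℕ) (r : Fin (k + 1)) : ℚ :=
  ((k : ℚ) - 1) ^ k * (uniformSimplex k).assocCoeff r

/-- The partitions of `n` into parts of size at least two. -/
def partitionsGeTwo (n : ℕ) : Finset (Nat.Partition n) :=
  Finset.univ.filter fun p => ∀ i ∈ p.parts, 2 ≤ i

/-- The derangements of `n` points whose cycle lengths are the parts of `p`. -/
def derangementsOfType {n : ℕ} (p : Nat.Partition n) : Set (Equiv.Perm (Fin n)) :=
  {σ | σ ∈ derangements (Fin n) ∧ σ.cycleType = p.parts}

/-!
The edges of the simplex are the complements of single vertices, so a choice of roots is a map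
sending each vertex `w` to a root of the edge missing `w`. If a vertex is a root `m` times, its
out-degree is `(k - 1) m` and its in-degree is `k - m`, so a balanced digraph forces `m = 1`
everywhere. The roots are then distinct, their order is determined, and the balanced rootings
correspond to the derangements `σ` of the vertices (`MultiHypergraph.IsRooting.exists_derangement`,
`assocCoeff_uniformSimplex`): the root `u` gets the edge missing `σ u`. All in-degrees are `k - 1`.
Connectedness plays no role, since a disconnected digraph has no spanning arborescence.

The digraph of `σ` is the complete digraph without the arcs `u → σ u`. Its arborescences are counted
by the directed matrix-tree theorem (`MultiDigraph.det_updateRow_inLaplacian`), proved by expanding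
a reduced Laplacian multilinearly over the choices of one entering arc at each vertex other than the
root. As the digraph is balanced, this minor is `1 / (k + 1)²` times the determinant of the
Laplacian plus the all-ones matrix (`Matrix.det_add_one_of_sum_eq_zero`), and that sum is the
transpose of `k + P_σ`, where `P_σ` is the permutation matrix. The determinant of `k + P_σ` is the
product of `k ^ p + (-1) ^ (p + 1)` over the cycle lengths `p` of `σ` (`det_supportMatrix`).
Grouping the derangements by cycle type gives the first formula. The second is the count of
permutations of a given cycle type, as a permutation of `n` points whose cycle lengths add up to `n`
has no fixed points.
-/

/-! ### Functional graphs and the directed matrix-tree theorem -/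

namespace MultiDigraph

variable {V R : Type*} [DecidableEq V] [CommRing R]

/-- The matrix of a parent function `p` with root `r`: the row of `r` is the unit vector
at `r`, and the row of any other `v` is the unit vector at `v` minus the one at `p v`. -/
def parentMatrix (R : Type*) [CommRing R] (r : V) (p : V → V) : Matrix V V R :=
  Matrix.of fun v => if v = r then Pi.single r 1 else Pi.single v 1 - Pi.single (p v) 1

theorem parentMatrix_root (r : V) (p : V → V) : parentMatrix R r p r = Pi.single r 1 :=
  if_pos rfl

theorem parentMatrix_of_ne {r v : V} (hv : v ≠ r) (p : V → V) :
    parentMatrix R r p v = Pi.single v 1 - Pi.single (p v) 1 :=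
  if_neg hv

variable [Fintype V]

/-- If every vertex reaches the root, the matrix is unitriangular for the distance to the root. -/
theorem det_parentMatrix_of_reaches {r : V} {p : V → V} (h : ∀ v, ∃ m, p^[m] v = r) :
    (parentMatrix R r p).det = 1 := by
  classical
  let b : V → ℕ := fun v => Nat.find (h v)
  have hb : ∀ v, v ≠ r → b (p v) < b v := by
    intro v hv
    have hspec : p^[b v] v = r := Nat.find_spec (h v)
    have hpos : b v ≠ 0 := fun h0 => hv (by simpa [h0] using hspec)
    obtain ⟨m, hm⟩ := Nat.exists_eq_succ_of_ne_zero hpos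
    rw [hm, Function.iterate_succ_apply] at hspec
    have : b (p v) ≤ m := Nat.find_min' (h (p v)) hspec
    omega
  have htri : (parentMatrix R r p).BlockTriangular (OrderDual.toDual ∘ b) := by
    intro i j hij
    have hij : b i < b j := hij
    have hji : j ≠ i := by rintro rfl; exact lt_irrefl _ hij
    by_cases hi : i = r
    · subst hi
      simp [parentMatrix, hji]
    · have hjp : j ≠ p i := by
        rintro rfl
        exact lt_asymm hij (hb i hi)
      simp [parentMatrix, hi, hji, hjp]
  rw [htri.det]
  refine Finset.prod_eq_one fun a _ => ?_
  have : (parentMatrix R r p).toSquareBlock (OrderDual.toDual ∘ b) a = 1 := by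
    ext ⟨i, hi⟩ ⟨j, hj⟩
    have hbij : b i = b j := OrderDual.toDual.injective (hi.trans hj.symm)
    by_cases hir : i = r
    · subst hir
      simp [Matrix.toSquareBlock_def, Matrix.one_apply, Pi.single_apply, parentMatrix_root,
        eq_comm]
    · have hjp : j ≠ p i := by
        rintro rfl
        exact (hb i hir).ne' hbij
      simp [Matrix.toSquareBlock_def, Matrix.one_apply, Pi.single_apply, parentMatrix_of_ne hir,
        hjp, eq_comm]
  rw [this, Matrix.det_one]

/-- If some vertex does not reach the root, the indicator of the set of all such vertices lies in
the kernel. -/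
theorem det_parentMatrix_of_not_reaches [IsDomain R] {r : V} {p : V → V}
    (h : ¬ ∀ v, ∃ m, p^[m] v = r) : (parentMatrix R r p).det = 0 := by
  classical
  rw [← Matrix.exists_mulVec_eq_zero_iff]
  push Not at h
  obtain ⟨v₀, hv₀⟩ := h
  refine ⟨fun v => if ∃ m, p^[m] v = r then 0 else 1, ?_, ?_⟩
  · intro h0
    have := congrFun h0 v₀
    simp [hv₀] at this
  · ext v
    by_cases hv : v = r
    · subst hv
      have : ∃ m, p^[m] v = v := ⟨0, rfl⟩
      simp [parentMatrix, Matrix.mulVec, this]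
    · have hiff : (∃ m, p^[m] v = r) ↔ ∃ m, p^[m] (p v) = r := by
        constructor
        · rintro ⟨m, hm⟩
          cases m with
          | zero => exact absurd hm hv
          | succ m => exact ⟨m, by rwa [Function.iterate_succ_apply] at hm⟩
        · rintro ⟨m, hm⟩
          exact ⟨m + 1, by rwa [Function.iterate_succ_apply]⟩
      rw [Matrix.mulVec, parentMatrix_of_ne hv, sub_dotProduct]
      simp [hiff]

variable (D : MultiDigraph V) (r : V)

/-- The possible values at `v` of a choice of one entering arc for each vertex other than `r`;
the root gets the dummy value `none`. -/
def enteringArcs (v : V) : Finset (Option D.Arc) :=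
  if v = r then {none} else (Finset.univ.filter fun a : D.Arc => a.1.2 = v).image some

variable {D r}

/-- The parent of `v` under a choice of entering arcs is the tail of the arc chosen at `v`. -/
def parent (g : V → Option D.Arc) (v : V) : V := (g v).elim v fun a => a.1.1

/-- The set of arcs selected by a choice of entering arcs. -/
def selectedArcs (g : V → Option D.Arc) : Finset D.Arc :=
  Finset.univ.filter fun a => g a.1.2 = some a

theorem apply_root_of_mem {g : V → Option D.Arc} (hg : g ∈ Fintype.piFinset (D.enteringArcs r)) :
    g r = none := by
  have := Fintype.mem_piFinset.1 hg r
  simpa [enteringArcs] using this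

theorem exists_apply_of_mem {g : V → Option D.Arc}
    (hg : g ∈ Fintype.piFinset (D.enteringArcs r)) {v : V} (hv : v ≠ r) :
    ∃ a : D.Arc, a.1.2 = v ∧ g v = some a := by
  have := Fintype.mem_piFinset.1 hg v
  rw [enteringArcs, if_neg hv, Finset.mem_image] at this
  obtain ⟨a, ha, hav⟩ := this
  exact ⟨a, (Finset.mem_filter.1 ha).2, hav.symm⟩

theorem mem_selectedArcs {g : V → Option D.Arc} {a : D.Arc} :
    a ∈ selectedArcs g ↔ g a.1.2 = some a := by
  simp [selectedArcs]

/-- A choice of entering arcs selects an arborescence exactly when following parents leads from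
every vertex to the root. -/
theorem isArborescence_selectedArcs {g : V → Option D.Arc}
    (hg : g ∈ Fintype.piFinset (D.enteringArcs r)) :
    D.IsArborescence r (selectedArcs g) ↔ ∀ v, ∃ m, (parent g)^[m] v = r := by
  have hstep : ∀ x y : V,
      (∃ a ∈ selectedArcs g, a.1 = (x, y)) ↔ y ≠ r ∧ parent g y = x := by
    intro x y
    constructor
    · rintro ⟨a, ha, hxy⟩
      rw [mem_selectedArcs, hxy] at ha
      refine ⟨?_, by simp [parent, ha, hxy]⟩
      rintro rfl
      simp [apply_root_of_mem hg] at ha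
    · rintro ⟨hy, rfl⟩
      obtain ⟨a, ha, hga⟩ := exists_apply_of_mem hg hy
      exact ⟨a, mem_selectedArcs.2 (by rw [ha, hga]), by subst ha; simp [parent, hga]⟩
  have hreach : ∀ v, Relation.ReflTransGen
      (fun x y => ∃ a ∈ selectedArcs g, a.1 = (x, y)) r v ↔ ∃ m, (parent g)^[m] v = r := by
    intro v
    simp only [hstep]
    constructor
    · intro h
      induction h with
      | refl => exact ⟨0, rfl⟩
      | tail _ hbc ih =>
        obtain ⟨m, hm⟩ := ih
        exact ⟨m + 1, by rw [Function.iterate_succ_apply, hbc.2, hm]⟩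
    · rintro ⟨m, hm⟩
      induction m generalizing v with
      | zero => rw [show v = r from hm]
      | succ m ih =>
        by_cases hv : v = r
        · rw [hv]
        · exact (ih _ (by rwa [Function.iterate_succ_apply] at hm)).tail ⟨hv, rfl⟩
  simp only [IsArborescence, hreach]
  refine ⟨fun h => h.2.2, fun h => ⟨?_, ?_, h⟩⟩
  · intro a ha har
    rw [mem_selectedArcs, har, apply_root_of_mem hg] at ha
    exact Option.some_ne_none _ ha.symm
  · intro v hv
    obtain ⟨a, ha, hga⟩ := exists_apply_of_mem hg hv
    refine ⟨a, ⟨mem_selectedArcs.2 (by rw [ha, hga]), ha⟩, ?_⟩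
    rintro a' ⟨ha', rfl⟩
    rw [mem_selectedArcs, hga] at ha'
    exact (Option.some_injective _ ha').symm

theorem injOn_selectedArcs :
    Set.InjOn selectedArcs
      (Fintype.piFinset (D.enteringArcs r) : Set (V → Option D.Arc)) := by
  intro g hg g' hg' h
  rw [Finset.mem_coe] at hg hg'
  ext1 v
  by_cases hv : v = r
  · rw [hv, apply_root_of_mem hg, apply_root_of_mem hg']
  · obtain ⟨a, rfl, hga⟩ := exists_apply_of_mem hg hv
    rw [hga]
    exact (mem_selectedArcs.1 (h ▸ mem_selectedArcs.2 hga)).symm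

theorem IsArborescence.exists_selectedArcs {T : Finset D.Arc} (hT : D.IsArborescence r T) :
    ∃ g ∈ Fintype.piFinset (D.enteringArcs r), selectedArcs g = T := by
  classical
  obtain ⟨hroot, huniq, -⟩ := hT
  choose a ha ha' using fun v : {v // v ≠ r} => huniq v v.2
  refine ⟨fun v => if hv : v = r then none else some (a ⟨v, hv⟩), ?_, ?_⟩
  · rw [Fintype.mem_piFinset]
    intro v
    by_cases hv : v = r
    · simp [enteringArcs, hv]
    · simpa [enteringArcs, hv] using (ha ⟨v, hv⟩).2
  · ext b
    rw [mem_selectedArcs]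
    by_cases hb : b.1.2 = r
    · simp only [hb, dite_true, reduceCtorEq, false_iff]
      exact fun hbT => hroot b hbT hb
    · simp only [hb, dite_false, Option.some.injEq]
      constructor
      · intro h
        rw [← h]
        exact (ha ⟨_, hb⟩).1
      · intro h
        exact (ha' ⟨_, hb⟩ b ⟨h, rfl⟩).symm

theorem numArborescences_eq_card [DecidablePred fun g : V → Option D.Arc =>
      ∀ v, ∃ m, (parent g)^[m] v = r] :
    D.numArborescences r =
      ((Fintype.piFinset (D.enteringArcs r)).filter
        fun g => ∀ v, ∃ m, (parent g)^[m] v = r).card := by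
  classical
  rw [numArborescences, ← Finset.card_image_of_injOn
    (injOn_selectedArcs.mono (Finset.coe_subset.2 (Finset.filter_subset _ _)))]
  refine Nat.subtype_card _ fun T => ?_
  rw [Finset.mem_image]
  constructor
  · rintro ⟨g, hg, rfl⟩
    rw [Finset.mem_filter] at hg
    exact (isArborescence_selectedArcs hg.1).2 hg.2
  · intro hT
    obtain ⟨g, hg, rfl⟩ := hT.exists_selectedArcs
    exact ⟨g, Finset.mem_filter.2 ⟨hg, (isArborescence_selectedArcs hg).1 hT⟩, rfl⟩

/-- The in-degree Laplacian of a multi-digraph. Row `v` describes the arcs entering `v`; a loop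
contributes nothing. -/
def inLaplacian (R : Type*) [CommRing R] (D : MultiDigraph V) : Matrix V V R :=
  Matrix.of fun v u => (if u = v then (D.inDeg v : R) else 0) - (D u v : R)

theorem inLaplacian_row (v : V) :
    D.inLaplacian R v =
      ∑ a ∈ Finset.univ.filter (fun a : D.Arc => a.1.2 = v),
        (Pi.single v 1 - Pi.single a.1.1 1 : V → R) := by
  ext u
  rw [Finset.sum_filter, Finset.sum_apply, Fintype.sum_sigma, Fintype.sum_prod_type]
  simp only [Finset.sum_const, Finset.card_univ, Fintype.card_fin, ite_apply, apply_ite]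
  simp [inLaplacian, inDeg, Pi.single_apply, Finset.sum_sub_distrib, mul_sub,
    Finset.sum_ite_eq]

/-- The directed matrix-tree theorem. By multilinearity in the rows, the determinant is a sum over
all ways of choosing one entering arc at each vertex other than `r`; the choices that form an
arborescence contribute `1` and the others `0`. -/
theorem det_updateRow_inLaplacian [IsDomain R] (D : MultiDigraph V) (r : V) :
    ((D.inLaplacian R).updateRow r (Pi.single r 1)).det = (D.numArborescences r : R) := by
  classical
  let w : V → Option D.Arc → V → R := fun v o =>
    o.elim (Pi.single v 1) fun a => Pi.single v 1 - Pi.single a.1.1 1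
  have hrows : (D.inLaplacian R).updateRow r (Pi.single r 1) =
      fun v => ∑ o ∈ D.enteringArcs r v, w v o := by
    funext v
    by_cases hv : v = r
    · subst hv
      simp [enteringArcs, w]
    · rw [Matrix.updateRow_ne hv, inLaplacian_row, enteringArcs, if_neg hv,
        Finset.sum_image (by simp)]
      rfl
  rw [hrows]
  change Matrix.detRowAlternating.toMultilinearMap
    (fun v => ∑ o ∈ D.enteringArcs r v, w v o) = _
  rw [MultilinearMap.map_sum_finset, numArborescences_eq_card, Finset.card_filter, Nat.cast_sum]
  refine Finset.sum_congr rfl fun g hg => ?_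
  have hmat : (fun v => w v (g v)) = parentMatrix R r (parent g) := by
    funext v
    by_cases hv : v = r
    · subst hv
      simp [w, parentMatrix_root, apply_root_of_mem hg]
    · obtain ⟨a, -, hga⟩ := exists_apply_of_mem hg hv
      simp [w, parentMatrix_of_ne hv, parent, hga]
  change Matrix.det (fun v => w v (g v)) = _
  rw [hmat]
  split_ifs with h
  · rw [det_parentMatrix_of_reaches h, Nat.cast_one]
  · rw [det_parentMatrix_of_not_reaches h, Nat.cast_zero]

end MultiDigraph

/-! ### Cofactors of a matrix with zero row and column sums -/

/-- Adding the all-ones matrix to a matrix with zero row and column sums turns the determinant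
into `n²` times the cofactor at `(r, r)`. -/
theorem Matrix.det_add_one_of_sum_eq_zero {V R : Type*} [Fintype V] [DecidableEq V] [CommRing R]
    {L : Matrix V V R} (hrow : ∀ i, ∑ j, L i j = 0) (hcol : ∀ j, ∑ i, L i j = 0) (r : V) :
    (L + Matrix.of fun _ _ => 1).det =
      (Fintype.card V : R) ^ 2 * (L.updateRow r (Pi.single r 1)).det := by
  set M : Matrix V V R := L + Matrix.of fun _ _ => 1 with hM
  set A : Matrix V V R := L.updateRow r fun _ => 1 with hA
  -- Replacing row `r` by the sum of all rows, which is constant, extracts a factor `n`.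
  have h1 : M.det = (Fintype.card V : R) * (M.updateRow r fun _ => 1).det := by
    have hs : ∑ i, (1 : R) • M i = (Fintype.card V : R) • fun _ => (1 : R) := by
      ext j
      refine (Finset.sum_apply j _ _).trans ?_
      simp [hM, Finset.sum_add_distrib, hcol]
    have := Matrix.det_updateRow_sum M r fun _ => 1
    rw [hs, Matrix.det_updateRow_smul, one_smul] at this
    exact this.symm
  -- Subtracting this row from the others removes the added ones.
  have h2 : (M.updateRow r fun _ => 1).det = A.det := by
    refine Matrix.det_eq_of_forall_row_eq_smul_add_const (fun i => if i = r then 0 else 1) r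
      (by simp) fun i j => ?_
    by_cases hi : i = r
    · subst hi
      simp [hA]
    · simp [hA, hM, hi]
  -- `A` maps the all-ones vector to `n • e_r`; now apply the adjugate.
  have h3 : A.mulVec (fun _ => 1) = Pi.single r (Fintype.card V : R) := by
    ext i
    by_cases hi : i = r
    · subst hi
      simp [hA, Matrix.mulVec, dotProduct]
    · simp [hA, Matrix.mulVec, dotProduct, hi, hrow]
  have h4 : A.det = (Fintype.card V : R) * (L.updateRow r (Pi.single r 1)).det := by
    have := congrFun (congrArg (fun B : Matrix V V R => B.mulVec fun _ => (1 : R))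
      (Matrix.adjugate_mul A)) r
    simp only [← Matrix.mulVec_mulVec, h3] at this
    rw [Matrix.mulVec_single, Matrix.smul_mulVec, Matrix.one_mulVec] at this
    simp only [Pi.smul_apply, smul_eq_mul, mul_one, Matrix.col_apply, MulOpposite.smul_eq_mul_unop,
      MulOpposite.unop_op] at this
    rw [Matrix.adjugate_apply, hA, Matrix.updateRow_idem, ← hA] at this
    rw [← this, mul_comm]
  rw [h1, h2, h4]
  ring

/-! ### The determinant of `x + P` for a permutation matrix `P` -/

section PermDet

open Equiv.Perm

variable {V R : Type*} [DecidableEq V] [CommRing R]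

/-- The matrix `x + P_σ` on the support of `σ`, extended by the identity to the fixed points. -/
def supportMatrix (x : R) (σ : Equiv.Perm V) : Matrix V V R :=
  Matrix.of fun i => if σ i = i then Pi.single i 1 else Pi.single i x + Pi.single (σ i) 1

theorem supportMatrix_of_fixed (x : R) {σ : Equiv.Perm V} {i : V} (hi : σ i = i) :
    supportMatrix x σ i = Pi.single i 1 :=
  if_pos hi

theorem supportMatrix_of_moved (x : R) {σ : Equiv.Perm V} {i : V} (hi : σ i ≠ i) :
    supportMatrix x σ i = Pi.single i x + Pi.single (σ i) 1 :=
  if_neg hi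

theorem supportMatrix_one (x : R) : supportMatrix x (1 : Equiv.Perm V) = 1 := by
  ext i j
  simp [supportMatrix, Matrix.one_apply, Pi.single_apply, eq_comm]

variable [Fintype V]

theorem supportMatrix_mul (x : R) {σ τ : Equiv.Perm V} (h : σ.Disjoint τ) :
    supportMatrix x (σ * τ) = supportMatrix x σ * supportMatrix x τ := by
  funext i
  rw [Matrix.mul_apply_eq_vecMul]
  by_cases hσ : σ i = i
  · rw [supportMatrix_of_fixed x hσ, Matrix.single_one_vecMul, Matrix.row]
    by_cases hτ : τ i = i
    · rw [supportMatrix_of_fixed x hτ, supportMatrix_of_fixed]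
      simp [hσ, hτ]
    · have hστ : (σ * τ) i = τ i := by rw [h.commute.eq, Equiv.Perm.mul_apply, hσ]
      rw [supportMatrix_of_moved x hτ, supportMatrix_of_moved, hστ]
      rwa [hστ]
  · have hτ : τ i = i := (h i).resolve_left hσ
    have hτσ : τ (σ i) = σ i := (h (σ i)).resolve_left fun h' => hσ (σ.injective h')
    have hστ : (σ * τ) i = σ i := by rw [Equiv.Perm.mul_apply, hτ]
    rw [supportMatrix_of_moved x hσ, Matrix.add_vecMul, Matrix.single_one_vecMul,
      Matrix.single_vecMul, Matrix.row_apply', Matrix.row_apply', supportMatrix_of_fixed x hτ,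
      supportMatrix_of_fixed x hτσ, supportMatrix_of_moved, hστ]
    · simp [← Pi.single_smul]
    · rwa [hστ]

/-- In the Leibniz expansion for a cycle, only the identity and the cycle itself contribute. -/
theorem det_supportMatrix_of_isCycle (x : R) {c : Equiv.Perm V} (hc : c.IsCycle) :
    (supportMatrix x c).det = x ^ c.support.card + (-1) ^ (c.support.card + 1) := by
  rw [← Matrix.det_transpose, Matrix.det_apply]
  have hterm : ∀ τ : Equiv.Perm V, τ ∉ ({1, c} : Finset (Equiv.Perm V)) →
      Equiv.Perm.sign τ • ∏ i, (supportMatrix x c).transpose (τ i) i = 0 := by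
    intro τ hτ
    simp only [Finset.mem_insert, Finset.mem_singleton, not_or] at hτ
    suffices ∃ i, supportMatrix x c i (τ i) = 0 by
      obtain ⟨i, hi⟩ := this
      rw [Finset.prod_eq_zero (Finset.mem_univ i) hi, smul_zero]
    by_contra hne
    push Not at hne
    have hcases : ∀ i, τ i = i ∨ τ i = c i := by
      intro i
      by_contra! h'
      refine hne i ?_
      by_cases hci : c i = i
      · simp [supportMatrix, hci, h'.1]
      · simp [supportMatrix, hci, h'.1, h'.2]
    -- Once `τ` agrees with `c` at a moved point, injectivity forces agreement along the cycle.
    obtain ⟨j, hj⟩ : ∃ j, τ j ≠ j := by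
      by_contra! h'
      exact hτ.1 (Equiv.ext h')
    have hτj : τ j = c j := (hcases j).resolve_left hj
    have hcj : c j ≠ j := hτj ▸ hj
    have hiter : ∀ m : ℕ, τ ((c ^ m) j) = c ((c ^ m) j) := by
      intro m
      induction m with
      | zero => simpa using hτj
      | succ m ih =>
        refine (hcases _).resolve_left fun h' => ?_
        rw [pow_succ', Equiv.Perm.mul_apply, ← ih] at h'
        have h2 := τ.injective h'
        rw [ih] at h2
        have h3 : (c ^ m) (c j) = (c ^ m) j := by
          rw [← Equiv.Perm.mul_apply, ← pow_succ, pow_succ', Equiv.Perm.mul_apply, h2]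
        exact hcj ((c ^ m).injective h3)
    refine hτ.2 (Equiv.ext fun i => ?_)
    by_cases hi : c i = i
    · rcases hcases i with h' | h'
      · rw [h', hi]
      · exact h'
    · obtain ⟨m, rfl⟩ := hc.exists_pow_eq hcj hi
      exact hiter m
  rw [← Finset.sum_subset (Finset.subset_univ ({1, c} : Finset (Equiv.Perm V)))
    fun τ _ hτ => hterm τ hτ, Finset.sum_pair hc.ne_one.symm]
  congr 1
  · have : ∀ i, supportMatrix x c i i =
        if i ∈ c.support then x else 1 := by
      intro i
      by_cases hi : c i = i
      · simp [supportMatrix, hi]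
      · simp [supportMatrix, hi, Ne.symm hi]
    simp only [Matrix.transpose_apply, Equiv.Perm.one_apply, this, Finset.prod_ite_mem]
    simp
  · have : ∀ i, supportMatrix x c i (c i) = 1 := by
      intro i
      by_cases hi : c i = i
      · simp [supportMatrix, hi]
      · simp [supportMatrix, hi]
    simp [this, hc.sign, Units.smul_def, pow_succ]

theorem det_supportMatrix (x : R) (σ : Equiv.Perm V) :
    (supportMatrix x σ).det = (σ.cycleType.map fun i => x ^ i + (-1) ^ (i + 1)).prod := by
  induction σ using cycle_induction_on with
  | base_one => simp [supportMatrix_one]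
  | base_cycles σ hσ => simp [det_supportMatrix_of_isCycle x hσ, hσ.cycleType]
  | induction_disjoint σ τ hd _ hσ hτ =>
    rw [supportMatrix_mul x hd, Matrix.det_mul, hσ, hτ, hd.cycleType_mul, Multiset.map_add,
      Multiset.prod_add]

end PermDet

/-! ### Euler rootings of the simplex -/

namespace MultiDigraph

variable {V : Type*} {D : MultiDigraph V} {r : V}

theorem Connected.of_numArborescences_ne_zero (h : D.numArborescences r ≠ 0) : D.Connected := by
  obtain ⟨⟨T, -, -, hT⟩⟩ := (Nat.card_ne_zero.1 h).1
  have hr : ∀ v, Relation.EqvGen (fun x y => 0 < D x y) r v := fun v => by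
    induction hT v with
    | refl => exact .refl _
    | tail _ hbc ih =>
      obtain ⟨⟨p, i⟩, -, rfl⟩ := hbc
      exact ih.trans _ _ _ (.rel _ _ i.pos)
  exact fun u v => ((hr u).symm _ _).trans _ _ _ (hr v)

/-- For a balanced multi-digraph, the matrix-tree theorem in terms of a full determinant. -/
theorem det_inLaplacian_add_one {R : Type*} [CommRing R] [IsDomain R] [Fintype V] [DecidableEq V]
    (h : ∀ v, D.inDeg v = D.outDeg v) (r : V) :
    (D.inLaplacian R + Matrix.of fun _ _ => 1).det =
      (Fintype.card V : R) ^ 2 * (D.numArborescences r : R) := by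
  rw [Matrix.det_add_one_of_sum_eq_zero _ _ r, det_updateRow_inLaplacian]
  · intro v
    simp [inLaplacian, inDeg]
  · intro u
    simp [inLaplacian, h, outDeg]

end MultiDigraph

section RootedDigraph

variable {V : Type*} [Fintype V] [DecidableEq V]

/-- In a list of stars on `k`-sets, a vertex has `k - 1` out-arcs for each time it is a root. -/
theorem outDeg_rootedDigraph {k : ℕ} {L : List (Finset V × V)}
    (hL : ∀ s ∈ L, s.2 ∈ s.1 ∧ s.1.card = k) (v : V) :
    (rootedDigraph L).outDeg v = (k - 1) * (L.map Prod.snd).count v := by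
  induction L with
  | nil => simp [rootedDigraph, MultiDigraph.outDeg]
  | cons s L ih =>
    obtain ⟨hs, hcard⟩ := hL s (by simp)
    have hstar : ∑ w, rootedStar s.1 s.2 v w = if s.2 = v then k - 1 else 0 := by
      by_cases hv : s.2 = v
      · subst hv
        have : (Finset.univ.filter fun w => w ∈ s.1 ∧ w ≠ s.2) = s.1.erase s.2 := by
          ext w
          simp [and_comm]
        simp [rootedStar, this, Finset.card_erase_of_mem hs, hcard]
      · simp [rootedStar, hv, Ne.symm hv]
    have ih := ih fun t ht => hL t (List.mem_cons_of_mem _ ht)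
    simp only [MultiDigraph.outDeg, rootedDigraph, List.map_cons, List.sum_cons,
      Finset.sum_add_distrib, List.count_cons, hstar] at ih ⊢
    rw [ih, mul_add, add_comm]
    by_cases hv : s.2 = v <;> simp [hv]

/-- Each edge containing `v` either has `v` as its root or contributes one arc into `v`. -/
theorem inDeg_rootedDigraph_add {L : List (Finset V × V)} (hL : ∀ s ∈ L, s.2 ∈ s.1) (v : V) :
    (rootedDigraph L).inDeg v + (L.map Prod.snd).count v =
      (L.map Prod.fst).countP fun e => v ∈ e := by
  induction L with
  | nil => simp [rootedDigraph, MultiDigraph.inDeg]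
  | cons s L ih =>
    have hs := hL s (by simp)
    have hstar : ∑ u, rootedStar s.1 s.2 u v = if v ∈ s.1 ∧ v ≠ s.2 then 1 else 0 := by
      by_cases hv : v ∈ s.1 ∧ v ≠ s.2 <;> simp [rootedStar, hv]
    have ih := ih fun t ht => hL t (List.mem_cons_of_mem _ ht)
    simp only [MultiDigraph.inDeg, rootedDigraph, List.map_cons, List.sum_cons,
      Finset.sum_add_distrib, List.count_cons, List.countP_cons, hstar] at ih ⊢
    rw [← ih]
    by_cases hv : s.2 = v
    · subst hv
      simp [hs]
      ring
    · by_cases hv' : v ∈ s.1 <;> simp [hv, hv', Ne.symm hv]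
      ring

end RootedDigraph

section Simplex

variable {k : ℕ}

theorem edges_uniformSimplex (k : ℕ) :
    (uniformSimplex k).edges =
      (Finset.univ : Finset (Fin (k + 1))).val.map fun u => ({u}ᶜ : Finset (Fin (k + 1))) := by
  refine (Multiset.Nodup.ext (Finset.nodup _) (Finset.univ.nodup.map fun u v h => ?_)).2
    fun e => ?_
  · simpa using h
  · change e ∈ Finset.powersetCard k Finset.univ ↔ _
    rw [Finset.mem_powersetCard, Multiset.mem_map]
    simp only [Finset.subset_univ, true_and, Finset.mem_val, Finset.mem_univ]
    constructor
    · intro he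
      obtain ⟨u, hu⟩ := Finset.card_eq_one.1 (show eᶜ.card = 1 by
        rw [Finset.card_compl, he, Fintype.card_fin]; omega)
      exact ⟨u, by rw [← hu, compl_compl]⟩
    · rintro ⟨u, rfl⟩
      simp [Finset.card_compl]

theorem countP_edges_uniformSimplex (v : Fin (k + 1)) :
    (uniformSimplex k).edges.countP (fun e => v ∈ e) = k := by
  rw [edges_uniformSimplex, Multiset.countP_map]
  have : (Finset.univ.filter fun u : Fin (k + 1) => v ∈ ({u}ᶜ : Finset (Fin (k + 1)))) =
      Finset.univ.erase v := by
    ext u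
    simp [eq_comm]
  change (Finset.univ.filter fun u : Fin (k + 1) => v ∈ ({u}ᶜ : Finset (Fin (k + 1)))).card = k
  rw [this, Finset.card_erase_of_mem (Finset.mem_univ v)]
  simp

/-- The rooting of the simplex in which `u` is the root of the edge missing `σ u`, the edges being
ordered by their roots. -/
def simplexRooting (σ : Equiv.Perm (Fin (k + 1))) : List (Finset (Fin (k + 1)) × Fin (k + 1)) :=
  (List.finRange (k + 1)).map fun u => ({σ u}ᶜ, u)

theorem simplexRooting_injective : Function.Injective (simplexRooting (k := k)) := by
  intro σ τ h
  ext1 u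
  simpa using List.map_inj_left.1 h u (List.mem_finRange u)

theorem map_snd_simplexRooting (σ : Equiv.Perm (Fin (k + 1))) :
    (simplexRooting σ).map Prod.snd = List.finRange (k + 1) := by
  simp [simplexRooting, Function.comp_def]

theorem isRooting_simplexRooting {σ : Equiv.Perm (Fin (k + 1))}
    (hσ : σ ∈ derangements (Fin (k + 1))) :
    (uniformSimplex k).IsRooting (simplexRooting σ) := by
  refine ⟨?_, ?_, ?_⟩
  · rw [edges_uniformSimplex, ← Multiset.map_univ_val_equiv σ, Multiset.map_map]
    simp [simplexRooting, Function.comp_def, Finset.univ, Fintype.elems]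
  · intro s hs
    obtain ⟨u, -, rfl⟩ := List.mem_map.1 hs
    simpa [eq_comm] using hσ u
  · rw [simplexRooting, List.pairwise_map]
    exact List.pairwise_le_finRange _

theorem rootedDigraph_simplexRooting (σ : Equiv.Perm (Fin (k + 1))) (x y : Fin (k + 1)) :
    rootedDigraph (simplexRooting σ) x y = if y = x ∨ y = σ x then 0 else 1 := by
  rw [rootedDigraph, simplexRooting, List.map_map, ← Fin.sum_univ_def]
  rw [Finset.sum_eq_single x]
  · by_cases hx : y = x <;> by_cases hσ : y = σ x <;> simp [rootedStar, hx, hσ]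
  · intro u _ hu
    simp [rootedStar, hu.symm]
  · simp

namespace MultiHypergraph.IsRooting

variable {L : List (Finset (Fin (k + 1)) × Fin (k + 1))}

theorem card_edge (hL : (uniformSimplex k).IsRooting L) {s : Finset (Fin (k + 1)) × Fin (k + 1)}
    (hs : s ∈ L) : s.1.card = k := by
  have : s.1 ∈ (uniformSimplex k).edges := by
    rw [← hL.1]
    exact Multiset.mem_coe.2 (List.mem_map_of_mem hs)
  rw [uniformSimplex, Finset.mem_val, Finset.mem_powersetCard] at this
  exact this.2

theorem outDeg_eq (hL : (uniformSimplex k).IsRooting L) (v : Fin (k + 1)) :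
    (rootedDigraph L).outDeg v = (k - 1) * (L.map Prod.snd).count v :=
  outDeg_rootedDigraph (fun s hs => ⟨hL.2.1 s hs, hL.card_edge hs⟩) v

theorem inDeg_add (hL : (uniformSimplex k).IsRooting L) (v : Fin (k + 1)) :
    (rootedDigraph L).inDeg v + (L.map Prod.snd).count v = k := by
  rw [inDeg_rootedDigraph_add hL.2.1, ← Multiset.coe_countP, hL.1, countP_edges_uniformSimplex]

/-- In a balanced rooting every vertex is a root exactly once: if it is a root `m` times, then
`k - m = (k - 1) m`. So the roots in order are all the vertices in order, and sending a root to
the vertex missing from its edge is a derangement. -/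
theorem exists_derangement (hk : 2 ≤ k) (hL : (uniformSimplex k).IsRooting L)
    (hbal : ∀ v, (rootedDigraph L).inDeg v = (rootedDigraph L).outDeg v) :
    ∃ σ ∈ derangements (Fin (k + 1)), simplexRooting σ = L := by
  have hcount : ∀ v, (L.map Prod.snd).count v = 1 := by
    intro v
    have h1 := hL.inDeg_add v
    rw [hbal, hL.outDeg_eq] at h1
    obtain ⟨j, rfl⟩ : ∃ j, k = j + 1 := ⟨k - 1, by omega⟩
    have h2 : (j + 1) * (L.map Prod.snd).count v = (j + 1) * 1 := by
      rw [Nat.add_sub_cancel] at h1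
      linarith
    exact Nat.eq_of_mul_eq_mul_left j.succ_pos h2
  have hsnd : L.map Prod.snd = List.finRange (k + 1) := by
    refine List.Perm.eq_of_pairwise' ?_ (List.pairwise_le_finRange _) ?_
    · exact List.pairwise_map.2 hL.2.2
    · rw [List.perm_iff_count]
      intro v
      rw [hcount, List.count_eq_one_of_mem (List.nodup_finRange _) (List.mem_finRange v)]
  have hlen : L.length = k + 1 := by
    simpa using congrArg List.length hsnd
  let f : Fin (k + 1) → Finset (Fin (k + 1)) := fun u => (L[u.1]'(by omega)).1
  have hLf : L = (List.finRange (k + 1)).map fun u => (f u, u) := by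
    refine List.ext_getElem (by simp [hlen]) fun i h1 h2 => ?_
    have : (L.map Prod.snd)[i]'(by simpa using h1) =
        (List.finRange (k + 1))[i]'(by simpa using h2) := by
      simp only [hsnd]
    rw [List.getElem_map] at this
    ext1
    · simp [f]
    · simpa using this
  have hf : ∀ u, ∃ w, ({w}ᶜ : Finset (Fin (k + 1))) = f u := by
    intro u
    have : f u ∈ (uniformSimplex k).edges := by
      rw [← hL.1]
      exact Multiset.mem_coe.2 (List.mem_map_of_mem (List.getElem_mem _))
    rw [edges_uniformSimplex, Multiset.mem_map] at this
    obtain ⟨w, -, hw⟩ := this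
    exact ⟨w, hw⟩
  have hfinj : Function.Injective f := by
    have hnd : ((L.map Prod.fst : List _) : Multiset (Finset (Fin (k + 1)))).Nodup := by
      rw [hL.1]
      exact Finset.nodup _
    rw [hLf, List.map_map, Multiset.coe_nodup] at hnd
    exact fun u v huv =>
      List.inj_on_of_nodup_map hnd (List.mem_finRange u) (List.mem_finRange v) huv
  choose s hs using hf
  have hsinj : Function.Injective s := fun u v huv => hfinj (by rw [← hs, ← hs, huv])
  refine ⟨Equiv.ofBijective s (Finite.injective_iff_bijective.1 hsinj), fun u => ?_, ?_⟩
  · have : u ∈ f u := by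
      refine hL.2.1 (f u, u) ?_
      rw [hLf]
      exact List.mem_map_of_mem (List.mem_finRange u)
    rw [← hs] at this
    simpa [eq_comm] using this
  · rw [simplexRooting, hLf]
    simp [hs]

end MultiHypergraph.IsRooting

section Derangement

variable {σ : Equiv.Perm (Fin (k + 1))}

theorem count_snd_simplexRooting (σ : Equiv.Perm (Fin (k + 1))) (v : Fin (k + 1)) :
    ((simplexRooting σ).map Prod.snd).count v = 1 := by
  rw [map_snd_simplexRooting,
    List.count_eq_one_of_mem (List.nodup_finRange _) (List.mem_finRange v)]

theorem outDeg_simplexRooting (hσ : σ ∈ derangements (Fin (k + 1))) (v : Fin (k + 1)) :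
    (rootedDigraph (simplexRooting σ)).outDeg v = k - 1 := by
  rw [(isRooting_simplexRooting hσ).outDeg_eq, count_snd_simplexRooting, mul_one]

theorem inDeg_simplexRooting (hσ : σ ∈ derangements (Fin (k + 1))) (v : Fin (k + 1)) :
    (rootedDigraph (simplexRooting σ)).inDeg v = k - 1 := by
  have := (isRooting_simplexRooting hσ).inDeg_add v
  rw [count_snd_simplexRooting] at this
  omega

/-- The digraph of a derangement `σ` is the complete digraph without the arcs `u → σ u`, so its
Laplacian plus the all-ones matrix is the transpose of `k + P_σ`. -/
theorem sq_mul_numArborescences (hk : 2 ≤ k) (hσ : σ ∈ derangements (Fin (k + 1)))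
    (r : Fin (k + 1)) :
    ((k : ℚ) + 1) ^ 2 * ((rootedDigraph (simplexRooting σ)).numArborescences r : ℚ) =
      (σ.cycleType.map fun i => (k : ℚ) ^ i + (-1) ^ (i + 1)).prod := by
  have h := MultiDigraph.det_inLaplacian_add_one (R := ℚ)
    (D := rootedDigraph (simplexRooting σ))
    (fun v => by rw [inDeg_simplexRooting hσ, outDeg_simplexRooting hσ]) r
  rw [Fintype.card_fin, Nat.cast_add_one] at h
  rw [← h, ← det_supportMatrix, ← Matrix.det_transpose (supportMatrix _ _)]
  congr 1
  ext v u
  have hu : σ u ≠ u := hσ u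
  rw [Matrix.transpose_apply, supportMatrix_of_moved _ hu]
  simp only [Matrix.add_apply, MultiDigraph.inLaplacian, Matrix.of_apply, inDeg_simplexRooting hσ,
    rootedDigraph_simplexRooting, Pi.add_apply, Pi.single_apply]
  have hk1 : ((k - 1 : ℕ) : ℚ) = k - 1 := by rw [Nat.cast_sub (by omega), Nat.cast_one]
  by_cases hvu : v = u
  · subst hvu
    simp [hk1, hu.symm]
  · by_cases hvσ : v = σ u <;> simp [hvu, hvσ, Ne.symm hvu, hu, hu.symm]

end Derangement

/-- The Euler rootings of the simplex are the rootings of derangements. A derangement whose digraph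
is disconnected would not give an Euler rooting, but it would have no arborescence either. -/
theorem assocCoeff_uniformSimplex (hk : 2 ≤ k) (r : Fin (k + 1)) :
    (uniformSimplex k).assocCoeff r =
      ∑ σ : Equiv.Perm (Fin (k + 1)) with σ ∈ derangements (Fin (k + 1)),
        ((rootedDigraph (simplexRooting σ)).numArborescences r : ℚ) / ((k : ℚ) - 1) ^ (k + 1) := by
  classical
  have hk1 : ((k - 1 : ℕ) : ℚ) = k - 1 := by rw [Nat.cast_sub (by omega), Nat.cast_one]
  have hterm : ∀ σ ∈ Finset.univ.filter
      (fun σ : Equiv.Perm (Fin (k + 1)) => σ ∈ derangements (Fin (k + 1))),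
      ((rootedDigraph (simplexRooting σ)).numArborescences r : ℚ) / ((k : ℚ) - 1) ^ (k + 1) =
        ((rootedDigraph (simplexRooting σ)).numArborescences r : ℚ) /
          ∏ v, ((rootedDigraph (simplexRooting σ)).inDeg v : ℚ) := by
    intro σ hσ
    simp [inDeg_simplexRooting (Finset.mem_filter.1 hσ).2, hk1]
  rw [Finset.sum_congr rfl hterm, MultiHypergraph.assocCoeff,
    ← Finset.sum_image (f := fun L : List (Finset (Fin (k + 1)) × Fin (k + 1)) =>
        ((rootedDigraph L).numArborescences r : ℚ) / ∏ v, ((rootedDigraph L).inDeg v : ℚ))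
      simplexRooting_injective.injOn]
  refine Finset.sum_subset ?_ ?_
  · intro L hL
    obtain ⟨hroot, -, hbal⟩ := (Set.Finite.mem_toFinset _).1 hL
    obtain ⟨σ, hσ, rfl⟩ := hroot.exists_derangement hk hbal
    exact Finset.mem_image_of_mem _ (Finset.mem_filter.2 ⟨Finset.mem_univ _, hσ⟩)
  · intro L hL hL'
    obtain ⟨σ, hσ, rfl⟩ := Finset.mem_image.1 hL
    have hσ := (Finset.mem_filter.1 hσ).2
    by_cases h0 : (rootedDigraph (simplexRooting σ)).numArborescences r = 0
    · rw [h0, Nat.cast_zero, zero_div]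
    · have hEuler : simplexRooting σ ∈ (uniformSimplex k).eulerRootings :=
        ⟨isRooting_simplexRooting hσ, .of_numArborescences_ne_zero h0, fun v => by
          rw [inDeg_simplexRooting hσ, outDeg_simplexRooting hσ]⟩
      exact absurd ((Set.Finite.mem_toFinset _).2 hEuler) hL'

end Simplex

/-! ### Derangements by cycle type -/

section CycleType

variable {n : ℕ}

theorem support_eq_univ_iff_mem_derangements {σ : Equiv.Perm (Fin n)} :
    σ.support = Finset.univ ↔ σ ∈ derangements (Fin n) := by
  simp [Finset.eq_univ_iff_forall, derangements]

theorem mem_derangements_of_cycleType {σ : Equiv.Perm (Fin n)} {p : n.Partition}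
    (h : σ.cycleType = p.parts) : σ ∈ derangements (Fin n) := by
  rw [← support_eq_univ_iff_mem_derangements, ← Finset.card_eq_iff_eq_univ,
    ← Equiv.Perm.sum_cycleType, h, p.parts_sum, Fintype.card_fin]

theorem ncard_derangementsOfType (p : n.Partition) :
    (derangementsOfType p).ncard =
      (Finset.univ.filter fun σ : Equiv.Perm (Fin n) => σ.cycleType = p.parts).card := by
  rw [← Set.ncard_coe_finset]
  congr 1
  ext σ
  simpa [derangementsOfType] using mem_derangements_of_cycleType

theorem ncard_derangementsOfType_mul {p : n.Partition} (hp : ∀ i ∈ p.parts, 2 ≤ i) :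
    (derangementsOfType p).ncard *
      (p.parts.prod * ∏ j ∈ Finset.Icc 2 n, (p.parts.count j).factorial) = n.factorial := by
  have h := Equiv.Perm.card_of_cycleType_mul_eq (Fin n) p.parts
  rw [if_pos ⟨by simp [p.parts_sum], hp⟩, ← ncard_derangementsOfType, p.parts_sum,
    Fintype.card_fin, Nat.sub_self, Nat.factorial_zero, one_mul] at h
  rw [← h]
  congr 2
  symm
  refine Finset.prod_subset (fun j hj => ?_) fun j _ hj => ?_
  · rw [Multiset.mem_toFinset] at hj
    exact Finset.mem_Icc.2 ⟨hp j hj, p.le_of_mem_parts hj⟩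
  · rw [Multiset.mem_toFinset] at hj
    rw [Multiset.count_eq_zero_of_notMem hj, Nat.factorial_zero]

/-- The partition of `n` formed by the cycle lengths of a derangement. -/
def cyclePartition (σ : Equiv.Perm (Fin n)) (hσ : σ ∈ derangements (Fin n)) : n.Partition where
  parts := σ.cycleType
  parts_pos := fun hi => zero_lt_two.trans_le (Equiv.Perm.two_le_of_mem_cycleType hi)
  parts_sum := by
    rw [Equiv.Perm.sum_cycleType, support_eq_univ_iff_mem_derangements.2 hσ, Finset.card_univ,
      Fintype.card_fin]

theorem sum_derangements_eq_sum_partitionsGeTwo {R : Type*} [CommSemiring R]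
    (F : Multiset ℕ → R) :
    ∑ σ : Equiv.Perm (Fin n) with σ ∈ derangements (Fin n), F σ.cycleType =
      ∑ p ∈ partitionsGeTwo n, ((derangementsOfType p).ncard : R) * F p.parts := by
  classical
  have hp : ∀ p ∈ partitionsGeTwo n, ((derangementsOfType p).ncard : R) * F p.parts =
      ∑ σ : Equiv.Perm (Fin n) with σ ∈ derangements (Fin n),
        if σ.cycleType = p.parts then F σ.cycleType else 0 := by
    intro p _
    rw [← Finset.sum_filter, Finset.filter_filter, ncard_derangementsOfType, ← nsmul_eq_mul,
      ← Finset.sum_const]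
    refine Finset.sum_congr ?_ ?_
    · ext σ
      simpa using mem_derangements_of_cycleType
    · intro σ hσ
      rw [(Finset.mem_filter.1 hσ).2.2]
  rw [Finset.sum_congr rfl hp, Finset.sum_comm]
  refine Finset.sum_congr rfl fun σ hσ => ?_
  have hσ := (Finset.mem_filter.1 hσ).2
  rw [Finset.sum_eq_single (cyclePartition σ hσ)]
  · exact (if_pos rfl).symm
  · intro q _ hq
    exact if_neg fun h => hq (Nat.Partition.ext h.symm)
  · intro h
    refine absurd ?_ h
    simpa [partitionsGeTwo, cyclePartition] using
      fun i => Equiv.Perm.two_le_of_mem_cycleType (σ := σ) (n := i)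

end CycleType

theorem corollaryC (k : ℕ) (hk : 2 ≤ k) :
    (∀ r : Fin (k + 1),
      simplexConstant k r =
        1 / (((k : ℚ) - 1) * ((k : ℚ) + 1) ^ 2) *
          ∑ p ∈ partitionsGeTwo (k + 1),
            ((derangementsOfType p).ncard : ℚ) *
              (p.parts.map fun i : ℕ => (k : ℚ) ^ i + (-1) ^ (i + 1)).prod) ∧
    ∀ p ∈ partitionsGeTwo (k + 1),
      ((derangementsOfType p).ncard : ℚ) =
        ((k + 1).factorial : ℚ) /
          (((p.parts.prod : ℕ) : ℚ) *
            ∏ j ∈ Finset.Icc 2 (k + 1), ((p.parts.count j).factorial : ℚ)) := by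
  constructor
  · intro r
    -- The `k + 1` in-degrees `k - 1` cancel the factor `(k - 1) ^ k` up to one `k - 1`.
    have hk1 : (k : ℚ) - 1 ≠ 0 := sub_ne_zero.2 (by exact_mod_cast (by omega : k ≠ 1))
    have hk2 : (k : ℚ) + 1 ≠ 0 := by positivity
    rw [simplexConstant, assocCoeff_uniformSimplex hk,
      ← sum_derangements_eq_sum_partitionsGeTwo
        (fun m => (m.map fun i : ℕ => (k : ℚ) ^ i + (-1) ^ (i + 1)).prod),
      Finset.mul_sum, Finset.mul_sum]
    refine Finset.sum_congr rfl fun σ hσ => ?_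
    rw [← sq_mul_numArborescences hk (Finset.mem_filter.1 hσ).2 r, pow_succ ((k : ℚ) - 1)]
    field_simp
  · intro p hp
    have hp2 := (Finset.mem_filter.1 hp).2
    have hprod : p.parts.prod ≠ 0 := fun h0 => by
      simpa using hp2 0 (Multiset.prod_eq_zero_iff.1 h0)
    rw [eq_div_iff]
    · exact_mod_cast ncard_derangementsOfType_mul hp2
    · refine mul_ne_zero (Nat.cast_ne_zero.2 hprod) (Finset.prod_ne_zero_iff.2 fun j _ => ?_)
      exact Nat.cast_ne_zero.2 (Nat.factorial_ne_zero _)
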